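/- Let $\Bbbk$ be a field and let $\mathcal F$ be the free nonsymmetric operad over $\Bbbk$ on two binary operations $x(*\,*)$ and $y(*\,*)$, written $x_1\prec x_2$ and $x_1\succ x_2$ respectively; the planar binary trees whose internal vertices are labelled by $x$ or $y$ (tree monomials) form a basis of $\mathcal F$. Let $\mathrm{Flex}$ be the operad of flexible algebras, defined by $(a,b,c)+(c,b,a)=0$, where $(a,b,c)=(ab)c-a(bc)$. Let $\mathrm{noncom}\text{-}\mathrm{Flex}$ be the nonsymmetric operad $\mathcal F/I$ underlying the white Manin product $\mathrm{As}\circ\mathrm{Flex}$, where $x=x_1x_2\otimes x_1x_2$, $y=x_1x_2\otimes x_2x_1$, and the operadic ideal $I$ is generated by the relations of arity $3$ between $x$ and $y$ that hold in $\mathrm{As}(3)\otimes\mathrm{Flex}(3)$. Consider the rewriting rules $$y(*\,y(*\,*))\rightarrow x(*\,x(*\,*))+y(y(*\,*)\,*)-x(x(*\,*)\,*)\qquad(1)$$ and $$\begin{aligned}y(*\,x(*\,x(*\,*)))\rightarrow{}& y(*\,x(x(*\,*)\,*))+x(*\,x(*\,y(*\,*)))-x(*\,x(y(*\,*)\,*))-y(x(*\,x(*\,*))\,*)\\&+x(y(*\,*)\,x(*\,*))-x(x(*\,*)\,y(*\,*))+x(x(*\,y(*\,*))\,*)\\&+y(x(x(*\,*)\,*)\,*)-x(x(y(*\,*)\,*)\,*).\qquad(2)\end{aligned}$$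 Identify each rule with the difference of its left-hand side and its right-hand side. Then: (a) rule (1) alone generates $I$; (b) there is an admissible monomial order (a well-order on the tree monomials of each arity that is strictly compatible with partial compositions) for which the left-hand sides of (1) and (2) are their leading monomials; (c) for every such order, $\{(1),(2)\}$ is a Gröbner basis of $I$: it generates $I$, and the leading monomial of every nonzero element of $I$ is divisible by (contains as a subtree pattern) the left-hand side of (1) or of (2). -/

import Mathlib

noncomputable section

namespace NonComFlex

/-! ### Tree monomials in two binary operations and the free nonsymmetric operad -/

/-- The two generating binary operations: `x` is `x₁ ≺ x₂` and `y` is `x₁ ≻ x₂`. -/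
inductive Op where
  | x
  | y
  deriving DecidableEq

/-- Tree monomials of the free nonsymmetric operad on two binary operations: planar binary trees
whose internal vertices carry an operation. The tree `leaf` is the operadic unit. -/
inductive Tree where
  | leaf : Tree
  | node : Op → Tree → Tree → Tree
  deriving DecidableEq

/-- The number of leaves. -/
def Tree.arity : Tree → ℕ
  | .leaf => 1
  | .node _ l r => l.arity + r.arity

/-- `graft s i t` grafts the tree `t` at the leaf number `i` of `s`
(leaves are numbered `0, 1, …, s.arity - 1` from left to right). -/
def Tree.graft : Tree → ℕ → Tree → Tree
  | .leaf, _, t => t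
  | .node o l r, i, t =>
      if i < l.arity then .node o (l.graft i t) r else .node o l (r.graft (i - l.arity) t)

/-- `MatchRoot s t`: the tree `s` occurs in `t` at the root, that is, `t` is obtained from `s` by
grafting trees at the leaves of `s`. -/
def Tree.MatchRoot : Tree → Tree → Prop
  | .leaf, _ => True
  | .node _ _ _, .leaf => False
  | .node o l r, .node o' l' r' => o = o' ∧ l.MatchRoot l' ∧ r.MatchRoot r'

/-- Divisibility of tree monomials: `s` occurs in `t`, at the root or further up. -/
def Tree.Divides (s : Tree) : Tree → Prop
  | .leaf => s.MatchRoot .leaf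
  | .node o l r => s.MatchRoot (.node o l r) ∨ s.Divides l ∨ s.Divides r

variable (k : Type*) [Field k]

/-- The direct sum of all components of the free nonsymmetric operad on `x`, `y`. -/
abbrev FreeOp := Tree →₀ k

/-- The arity `n` component of the free nonsymmetric operad. -/
def component (n : ℕ) : Submodule k (FreeOp k) :=
  Finsupp.supported k k {t : Tree | t.arity = n}

variable {k}

/-- The partial composition `f ∘ᵢ g`, the bilinear extension of grafting. -/
def comp (i : ℕ) (f g : FreeOp k) : FreeOp k :=
  f.sum fun s a => g.sum fun t b => Finsupp.single (s.graft i t) (a * b)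

/-- `InIdeal S n f`: the element `f` of arity `n` lies in the operadic ideal generated by the
homogeneous elements of `S`, the smallest family of subspaces of the components that contains `S`
and is closed under partial compositions with arbitrary elements on both sides. -/
inductive InIdeal (S : Set (FreeOp k)) : ℕ → FreeOp k → Prop
  | of {n : ℕ} {f : FreeOp k} (hf : f ∈ S) (hn : f ∈ component k n) : InIdeal S n f
  | zero (n : ℕ) : InIdeal S n 0
  | add {n : ℕ} {f g : FreeOp k} (hf : InIdeal S n f) (hg : InIdeal S n g) : InIdeal S n (f + g)
  | smul {n : ℕ} (c : k) {f : FreeOp k} (hf : InIdeal S n f) : InIdeal S n (c • f)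
  | comp_left {m n i : ℕ} {f g : FreeOp k} (hf : InIdeal S m f) (hg : g ∈ component k n)
      (hi : i < m) : InIdeal S (m + n - 1) (comp i f g)
  | comp_right {m n i : ℕ} {f g : FreeOp k} (hf : f ∈ component k m) (hg : InIdeal S n g)
      (hi : i < m) : InIdeal S (m + n - 1) (comp i f g)

/-- The operadic ideal generated by `S`, as a family of subspaces. -/
def operadIdeal (S : Set (FreeOp k)) (n : ℕ) : Submodule k (FreeOp k) where
  carrier := {f | InIdeal S n f}
  add_mem' := InIdeal.add
  zero_mem' := InIdeal.zero n
  smul_mem' := fun c _ hf => InIdeal.smul c hf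

/-! ### Monomial orders and Gröbner bases -/

/-- An admissible monomial order: a well-order on the tree monomials of each arity (trees of
different arities are not compared), strictly compatible with both arguments of every partial
composition. -/
structure IsMonomialOrder (lt : Tree → Tree → Prop) : Prop where
  arity_eq : ∀ {s t : Tree}, lt s t → s.arity = t.arity
  irrefl : ∀ t : Tree, ¬ lt t t
  trans : ∀ {s t u : Tree}, lt s t → lt t u → lt s u
  total : ∀ {s t : Tree}, s.arity = t.arity → s ≠ t → lt s t ∨ lt t s
  wf : WellFounded lt
  graft_left : ∀ {s s' : Tree} (i : ℕ) (t : Tree), i < s.arity → lt s s' →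
    lt (s.graft i t) (s'.graft i t)
  graft_right : ∀ (s : Tree) (i : ℕ) {t t' : Tree}, i < s.arity → lt t t' →
    lt (s.graft i t) (s.graft i t')

/-- `t` is the leading tree monomial of `f`. -/
def IsLeading (lt : Tree → Tree → Prop) (f : FreeOp k) (t : Tree) : Prop :=
  t ∈ f.support ∧ ∀ s ∈ f.support, s ≠ t → lt s t

/-- `G` is a Gröbner basis of the operadic ideal `I`: it consists of homogeneous elements,
it generates `I`, and the leading monomial of every nonzero element of `I` is divisible by the
leading monomial of an element of `G`. -/
structure IsGroebnerBasis (lt : Tree → Tree → Prop) (G : Set (FreeOp k))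
    (I : ℕ → Submodule k (FreeOp k)) : Prop where
  homogeneous : ∀ g ∈ G, ∃ n, g ∈ component k n
  generates : operadIdeal G = I
  leading : ∀ (n : ℕ), ∀ f ∈ I n, f ≠ 0 →
    ∃ g ∈ G, ∃ s t : Tree, IsLeading lt g s ∧ IsLeading lt f t ∧ s.Divides t

/-! ### The operad `As ∘ Flex` -/

/-- The magma monomial obtained from a tree, with variables `i, i + 1, …` at its leaves
from left to right, through `a ≺ b = ab` and `a ≻ b = ba`. -/
def flexMon : Tree → ℕ → FreeNonUnitalNonAssocAlgebra k ℕ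
  | .leaf, i => FreeNonUnitalNonAssocAlgebra.of k i
  | .node .x l r, i => flexMon l i * flexMon r (i + l.arity)
  | .node .y l r, i => flexMon r (i + l.arity) * flexMon l i

/-- The associative monomial obtained from a tree, with variables `i, i + 1, …` at its leaves
from left to right, when both operations are read as the associative product. -/
def asMon : Tree → ℕ → FreeAlgebra k ℕ
  | .leaf, i => FreeAlgebra.ι k i
  | .node _ l r, i => asMon l i * asMon r (i + l.arity)

/-- The value `(ab)c - a(bc) + (cb)a - c(ba)` of the flexible law `(a,b,c) + (c,b,a) = 0`. -/
def flexLaw (a b c : FreeNonUnitalNonAssocAlgebra k ℕ) : FreeNonUnitalNonAssocAlgebra k ℕ :=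
  a * b * c - a * (b * c) + c * b * a - c * (b * a)

variable (k)

/-- The `S₃`-module of defining relations of the operad `Flex`, in the multilinear elements of
degree three in the variables `0, 1, 2` of the free magmatic algebra. -/
def flexRel : Submodule k (FreeNonUnitalNonAssocAlgebra k ℕ) :=
  Submodule.span k (Set.range fun σ : Equiv.Perm (Fin 3) =>
    flexLaw (FreeNonUnitalNonAssocAlgebra.of k (σ 0 : ℕ))
      (FreeNonUnitalNonAssocAlgebra.of k (σ 1 : ℕ))
      (FreeNonUnitalNonAssocAlgebra.of k (σ 2 : ℕ)))

/-- The map that sends `x` to `x₁x₂ ⊗ x₁x₂` and `y` to `x₁x₂ ⊗ x₂x₁`; restricted to arity three,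
it takes its values in `As(3) ⊗ Flex(3)`. -/
def toAsFlex : FreeOp k →ₗ[k]
    TensorProduct k (FreeAlgebra k ℕ) (FreeNonUnitalNonAssocAlgebra k ℕ ⧸ flexRel k) :=
  Finsupp.linearCombination k fun t : Tree =>
    TensorProduct.tmul k (asMon t 0) (Submodule.Quotient.mk (flexMon t 0))

/-- The ideal of relations of the operad `non-com-Flex`, the white Manin product `As ∘ Flex` in its
nonsymmetric form: it is generated by the quadratic relations between the operations `x` and `y`
that hold in `As(3) ⊗ Flex(3)`. -/
def nonComFlexIdeal : ℕ → Submodule k (FreeOp k) :=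
  operadIdeal {f : FreeOp k | f ∈ component k 3 ∧ toAsFlex k f = 0}

/-! ### The rewriting rules -/

/-- The left-hand side `y(*, y(*, *))` of the first rule. -/
def lead₁ : Tree := .node .y .leaf (.node .y .leaf .leaf)

/-- The left-hand side `y(*, x(*, x(*, *)))` of the second rule. -/
def lead₂ : Tree := .node .y .leaf (.node .x .leaf (.node .x .leaf .leaf))

/-- A tree monomial as an element of the free operad. -/
def mon (t : Tree) : FreeOp k := Finsupp.single t 1

open NonComFlex.Tree in
/-- Left-hand side minus right-hand side of the first rule. -/
def rule₁ : FreeOp k :=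
  let X := node .x
  let Y := node .y
  mon k lead₁
    - (mon k (X leaf (X leaf leaf))
      + mon k (Y (Y leaf leaf) leaf)
      - mon k (X (X leaf leaf) leaf))

open NonComFlex.Tree in
/-- Left-hand side minus right-hand side of the second rule. -/
def rule₂ : FreeOp k :=
  let X := node .x
  let Y := node .y
  mon k lead₂
    - (mon k (Y leaf (X (X leaf leaf) leaf))
      + mon k (X leaf (X leaf (Y leaf leaf)))
      - mon k (X leaf (X (Y leaf leaf) leaf))
      - mon k (Y (X leaf (X leaf leaf)) leaf)
      + mon k (X (Y leaf leaf) (X leaf leaf))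
      - mon k (X (X leaf leaf) (Y leaf leaf))
      + mon k (X (X leaf (Y leaf leaf)) leaf)
      + mon k (Y (X (X leaf leaf) leaf) leaf)
      - mon k (X (X (Y leaf leaf) leaf) leaf))

end NonComFlex

end

noncomputable section

namespace NonComFlex

open NonComFlex.Tree

variable {k : Type*} [Field k]

/-! The Gröbner property is proved with a model instead of a confluence argument. Keep `x` free on
the space of all tree monomials and replace `y` by a bilinear product `ymul`, which carries out the
rewriting by recursion on the right factor. Rule (2) then holds in the model almost by construction.
Rule (1) is the real point (`ymul_ymul`): its proof by induction on the right factor resolves the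
two overlaps `y(*,y(*,y(*,*)))` and `y(*,y(*,x(*,x(*,*))))`.

Since rule (1) holds identically, evaluating trees in the model kills the whole ideal. With every
variable sent to `leaf`, a tree divisible by neither left-hand side evaluates to itself
(`evalTree_eq_mon`), and any tree evaluates to a combination of trees not exceeding it
(`evalTree_mem_below`). If the leading monomial of an element of the ideal were divisible by
neither, its coefficient would survive in the evaluation, which is zero. The model does not involve
the order, so a single model serves every order.

Rule (2) is an S-polynomial of rule (1) with itself. The order required in (b) compares root-to-leaf
words of labels, from the last leaf to the first. For (a), the coefficient symmetries of the
flexible law leave only the multiples of rule (1) among the relations of arity three. -/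

/-- The bilinear extension of `Tree.node o`. -/
def nodeMul (k : Type*) [Field k] (o : Op) : FreeOp k →ₗ[k] FreeOp k →ₗ[k] FreeOp k :=
  Finsupp.linearCombination k fun l : Tree =>
    (Finsupp.lmapDomain k k (node o l) : FreeOp k →ₗ[k] FreeOp k)

@[simp]
theorem nodeMul_mon (o : Op) (l r : Tree) :
    nodeMul k o (mon k l) (mon k r) = mon k (node o l r) := by
  simp [nodeMul, mon]

/-! ### The model: the rewritten product and its two identities -/

/-- A weight that decreases along the rewriting of a product in its right factor. -/
def Tree.weight : Tree → ℕ
  | .leaf => 1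
  | .node _ l r => l.weight + 2 * r.weight

theorem Tree.weight_pos (t : Tree) : 0 < t.weight := by
  induction t <;> simp only [Tree.weight] <;> omega

/-- The trees `c` that the rewriting of `y(*, c)` does not touch. The clause for `y` makes
`y(b, c)` reducible as a right factor exactly if `c` is not. -/
def Tree.Inert : Tree → Bool
  | .leaf => true
  | .node .y _ c => !c.Inert
  | .node .x _ .leaf => true
  | .node .x _ (.node .y _ _) => true
  | .node .x _ (.node .x _ _) => false

/-- Right multiplication by a tree for the rewritten operation `y`. -/
def ymulRight (k : Type*) [Field k] : Tree → (FreeOp k →ₗ[k] FreeOp k)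
  | .leaf => (nodeMul k .y).flip (mon k leaf)
  | .node .y b c =>
      -- This is rule (1). If `c` is not inert, `y(b, c)` is itself reducible and the product is
      -- left plain: rule (1) must hold for the rewritten `y(b, c)`, and no value on the plain tree
      -- is needed for that.
      if c.Inert then
        (nodeMul k .x).flip (nodeMul k .x (mon k b) (mon k c))
          + ymulRight k c ∘ₗ ymulRight k b
          - (nodeMul k .x).flip (mon k c) ∘ₗ (nodeMul k .x).flip (mon k b)
      else (nodeMul k .y).flip (mon k (node .y b c))
  | .node .x b .leaf => (nodeMul k .y).flip (mon k (node .x b leaf))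
  | .node .x b (.node .y c d) => (nodeMul k .y).flip (mon k (node .x b (node .y c d)))
  | .node .x b (.node .x c d) =>
      -- These are the nine terms of rule (2) as functions of the left factor, every `y` being the
      -- rewritten one. The weight drops from `b + 2c + 4d` to `b + 2c + 2d` in the first term; the
      -- other calls are on subtrees.
      ymulRight k (node .x (node .x b c) d)
        + (nodeMul k .x).flip (nodeMul k .x (mon k b) (ymulRight k d (mon k c)))
        - (nodeMul k .x).flip (nodeMul k .x (ymulRight k c (mon k b)) (mon k d))
        - ymulRight k d ∘ₗ (nodeMul k .x).flip (nodeMul k .x (mon k b) (mon k c))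
        + (nodeMul k .x).flip (nodeMul k .x (mon k c) (mon k d)) ∘ₗ ymulRight k b
        - (nodeMul k .x).flip (ymulRight k d (mon k c)) ∘ₗ (nodeMul k .x).flip (mon k b)
        + (nodeMul k .x).flip (mon k d) ∘ₗ (nodeMul k .x).flip (ymulRight k c (mon k b))
        + ymulRight k d ∘ₗ (nodeMul k .x).flip (mon k c) ∘ₗ (nodeMul k .x).flip (mon k b)
        - (nodeMul k .x).flip (mon k d) ∘ₗ (nodeMul k .x).flip (mon k c) ∘ₗ ymulRight k b
  termination_by t => t.weight
  decreasing_by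
    all_goals
      simp only [Tree.weight]
      try have := Tree.weight_pos b
      try have := Tree.weight_pos c
      try have := Tree.weight_pos d
      omega

/-- The operation `y` on the space of tree monomials, modulo the rewriting rules. -/
def ymul (k : Type*) [Field k] : FreeOp k →ₗ[k] FreeOp k →ₗ[k] FreeOp k :=
  (Finsupp.linearCombination k (ymulRight k)).flip

theorem ymul_mon (f : FreeOp k) (t : Tree) : ymul k f (mon k t) = ymulRight k t f := by
  simp [ymul, mon]

/-- Two linear maps on the free operad agree as soon as they agree on tree monomials. -/
theorem linearMap_ext_mon {M : Type*} [AddCommMonoid M] [Module k M] {F G : FreeOp k →ₗ[k] M}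
    (h : ∀ t, F (mon k t) = G (mon k t)) : F = G :=
  Finsupp.lhom_ext' fun t => LinearMap.ext_ring (h t)

theorem induction_mon {P : FreeOp k → Prop} (f : FreeOp k) (h0 : P 0)
    (hadd : ∀ f g, P f → P g → P (f + g)) (hsmul : ∀ (c : k) f, P f → P (c • f))
    (hmon : ∀ t, P (mon k t)) : P f := by
  induction f using Finsupp.induction_linear with
  | zero => exact h0
  | add f g hf hg => exact hadd f g hf hg
  | single t a => simpa [mon] using hsmul a _ (hmon t)

/-- The second rule holds as an identity for `nodeMul k .x` and `ymul`. -/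
theorem ymul_x_x (a b c d : FreeOp k) :
    ymul k a (nodeMul k .x b (nodeMul k .x c d)) =
      ymul k a (nodeMul k .x (nodeMul k .x b c) d)
      + nodeMul k .x a (nodeMul k .x b (ymul k c d))
      - nodeMul k .x a (nodeMul k .x (ymul k b c) d)
      - ymul k (nodeMul k .x a (nodeMul k .x b c)) d
      + nodeMul k .x (ymul k a b) (nodeMul k .x c d)
      - nodeMul k .x (nodeMul k .x a b) (ymul k c d)
      + nodeMul k .x (nodeMul k .x a (ymul k b c)) d
      + ymul k (nodeMul k .x (nodeMul k .x a b) c) d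
      - nodeMul k .x (nodeMul k .x (ymul k a b) c) d := by
  induction b using induction_mon with
  | h0 => simp
  | hadd f g hf hg => simp only [map_add, LinearMap.add_apply, hf, hg]; abel
  | hsmul r f hf => simp only [map_smul, LinearMap.smul_apply, hf, smul_add, smul_sub]
  | hmon b =>
  induction c using induction_mon with
  | h0 => simp
  | hadd f g hf hg => simp only [map_add, LinearMap.add_apply, hf, hg]; abel
  | hsmul r f hf => simp only [map_smul, LinearMap.smul_apply, hf, smul_add, smul_sub]
  | hmon c =>
  induction d using induction_mon with
  | h0 => simp
  | hadd f g hf hg => simp only [map_add, hf, hg]; abel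
  | hsmul r f hf => simp only [map_smul, hf, smul_add, smul_sub]
  | hmon d =>
  simp only [nodeMul_mon, ymul_mon]
  rw [ymulRight]
  simp only [LinearMap.sub_apply, LinearMap.add_apply, LinearMap.comp_apply, LinearMap.flip_apply,
    nodeMul_mon]

theorem ymul_y_mon (a : FreeOp k) (b : Tree) {c : Tree} (hc : c.Inert) :
    ymul k a (mon k (node .y b c)) =
      nodeMul k .x a (nodeMul k .x (mon k b) (mon k c)) + ymul k (ymul k a (mon k b)) (mon k c)
      - nodeMul k .x (nodeMul k .x a (mon k b)) (mon k c) := by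
  simp only [ymul_mon]
  rw [ymulRight, if_pos hc]
  simp only [LinearMap.sub_apply, LinearMap.add_apply, LinearMap.comp_apply, LinearMap.flip_apply,
    nodeMul_mon]

theorem ymul_y (a b : FreeOp k) {c : Tree} (hc : c.Inert) :
    ymul k a (nodeMul k .y b (mon k c)) =
      nodeMul k .x a (nodeMul k .x b (mon k c)) + ymul k (ymul k a b) (mon k c)
      - nodeMul k .x (nodeMul k .x a b) (mon k c) := by
  induction b using induction_mon with
  | h0 => simp
  | hadd f g hf hg => simp only [map_add, LinearMap.add_apply, hf, hg]; abel
  | hsmul r f hf => simp only [map_smul, LinearMap.smul_apply, hf, smul_add, smul_sub]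
  | hmon b => rw [nodeMul_mon, ymul_y_mon a b hc]

/-- Inert trees are exactly those whose clause in `ymulRight` is the plain product. This is what
lets plain and rewritten occurrences of `y` be identified. -/
theorem ymul_eq_nodeMul {c : Tree} (hc : c.Inert) (b : FreeOp k) :
    ymul k b (mon k c) = nodeMul k .y b (mon k c) := by
  rw [ymul_mon]
  match c, hc with
  | .leaf, _ => rw [ymulRight]; rfl
  | .node .x d .leaf, _ => rw [ymulRight]; rfl
  | .node .x d (.node .y e f), _ => rw [ymulRight]; rfl
  | .node .y d e, hc =>
    rw [ymulRight, if_neg (by simpa [Tree.Inert] using hc)]; rfl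

/-- The first rule holds as an identity for `nodeMul k .x` and `ymul`. -/
theorem ymul_ymul_mon (n : ℕ) : ∀ c : Tree, c.weight = n → ∀ a b : FreeOp k,
    ymul k a (ymul k b (mon k c)) =
      nodeMul k .x a (nodeMul k .x b (mon k c)) + ymul k (ymul k a b) (mon k c)
      - nodeMul k .x (nodeMul k .x a b) (mon k c) := by
  induction n using Nat.strong_induction_on with
  | _ n ih =>
  intro c hc a b
  by_cases hI : c.Inert
  · rw [ymul_eq_nodeMul hI, ymul_y _ _ hI]
  match c, hc with
  | .leaf, _ => exact absurd rfl hI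
  | .node .x d .leaf, _ => exact absurd rfl hI
  | .node .x d (.node .y e f), _ => exact absurd rfl hI
  | .node .y d e, hc =>
    have hE : e.Inert := by simpa [Tree.Inert] using hI
    simp only [Tree.weight] at hc
    have hd := d.weight_pos
    have he := e.weight_pos
    have ihd := ih d.weight (by omega) d rfl
    have ihe := ih e.weight (by omega) e rfl
    rw [ymul_y_mon _ _ hE, ymul_y_mon _ _ hE]
    -- Overlap `y(a,y(b,y(d,e)))`. Rule (2) produces the rewritten product of `d` and `e` where the
    -- right-hand side has the plain tree `y(d,e)`; they agree because `e` is inert.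
    simp only [map_add, map_sub, LinearMap.add_apply, LinearMap.sub_apply, ihd, ihe, ymul_x_x,
      ← nodeMul_mon, ymul_eq_nodeMul hE (mon k d)]
    abel
  | .node .x d (.node .x e f), hc =>
    simp only [Tree.weight] at hc
    have hd := d.weight_pos
    have he := e.weight_pos
    have hf := f.weight_pos
    have ihd := ih d.weight (by omega) d rfl
    have ihe := ih e.weight (by omega) e rfl
    have ihf := ih f.weight (by omega) f rfl
    -- Overlap `y(a,y(b,x(d,x(e,f))))`: the first term of rule (2) is no subtree, only lighter,
    -- hence an induction on weight.
    have ihx := ih _ (by simp only [Tree.weight]; omega) (node .x (node .x d e) f) rfl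
    simp only [← nodeMul_mon] at ihx ⊢
    simp only [map_add, map_sub, LinearMap.add_apply, LinearMap.sub_apply, ihd, ihe, ihf, ihx,
      ymul_x_x]
    abel

theorem ymul_ymul (a b c : FreeOp k) :
    ymul k a (ymul k b c) =
      nodeMul k .x a (nodeMul k .x b c) + ymul k (ymul k a b) c
      - nodeMul k .x (nodeMul k .x a b) c := by
  induction c using induction_mon with
  | h0 => simp
  | hadd f g hf hg => simp only [map_add, hf, hg]; abel
  | hsmul r f hf => simp only [map_smul, hf, smul_add, smul_sub]
  | hmon c => exact ymul_ymul_mon _ c rfl a b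

/-! ### Grafting, arities and components -/

theorem Tree.arity_pos (t : Tree) : 0 < t.arity := by
  induction t <;> simp only [Tree.arity] <;> omega

theorem Tree.arity_graft (s t : Tree) {i : ℕ} (hi : i < s.arity) :
    (s.graft i t).arity = s.arity + t.arity - 1 := by
  have ht := t.arity_pos
  induction s generalizing i with
  | leaf => simp [Tree.graft, Tree.arity]
  | node o l r hl hr =>
    simp only [Tree.arity] at hi ⊢
    rw [Tree.graft]
    split_ifs with h
    · have := hl h
      simp only [Tree.arity]; omega
    · have := hr (i := i - l.arity) (by omega)
      simp only [Tree.arity]; omega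

theorem mem_component {n : ℕ} {f : FreeOp k} :
    f ∈ component k n ↔ ∀ t ∈ f.support, t.arity = n := by
  simp [component, Finsupp.mem_supported, Set.subset_def]

theorem mon_mem_component (t : Tree) : mon k t ∈ component k t.arity :=
  Finsupp.single_mem_supported k 1 rfl

theorem comp_mon (i : ℕ) (s t : Tree) : comp i (mon k s) (mon k t) = mon k (s.graft i t) := by
  simp only [comp, mon]
  rw [Finsupp.sum_single_index (by simp), Finsupp.sum_single_index (by simp), mul_one]

/-- Partial composition as a bilinear map. -/
def compLin (k : Type*) [Field k] (i : ℕ) : FreeOp k →ₗ[k] FreeOp k →ₗ[k] FreeOp k :=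
  Finsupp.linearCombination k fun s : Tree =>
    (Finsupp.lmapDomain k k (s.graft i) : FreeOp k →ₗ[k] FreeOp k)

theorem compLin_apply (i : ℕ) (f g : FreeOp k) : comp i f g = compLin k i f g := by
  simp [comp, compLin, Finsupp.linearCombination_apply, Finsupp.sum, LinearMap.sum_apply,
    Finsupp.mapDomain, Finset.smul_sum]

theorem comp_mem_component {m n i : ℕ} {f g : FreeOp k} (hf : f ∈ component k m)
    (hg : g ∈ component k n) (hi : i < m) : comp i f g ∈ component k (m + n - 1) := by
  rw [mem_component] at hf hg
  refine Submodule.sum_mem _ fun s hs => Submodule.sum_mem _ fun t ht => ?_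
  refine Finsupp.single_mem_supported k _ ?_
  rw [Set.mem_ofPred_eq, Tree.arity_graft _ _ (by rw [hf s hs]; exact hi), hf s hs, hg t ht]

theorem InIdeal.mem_component {S : Set (FreeOp k)} {n : ℕ} {f : FreeOp k} (h : InIdeal S n f) :
    f ∈ component k n := by
  induction h with
  | of _ hn => exact hn
  | zero => exact zero_mem _
  | add _ _ hf hg => exact add_mem hf hg
  | smul c _ hf => exact Submodule.smul_mem _ c hf
  | comp_left _ hg hi hf => exact comp_mem_component hf hg hi
  | comp_right hf _ hi hg => exact comp_mem_component hf hg hi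

theorem InIdeal.sub {S : Set (FreeOp k)} {n : ℕ} {f g : FreeOp k} (hf : InIdeal S n f)
    (hg : InIdeal S n g) : InIdeal S n (f - g) :=
  (operadIdeal S n).sub_mem hf hg

theorem InIdeal.trans {S T : Set (FreeOp k)} (h : ∀ n, ∀ f ∈ S, f ∈ component k n → InIdeal T n f)
    {n : ℕ} {f : FreeOp k} (hf : InIdeal S n f) : InIdeal T n f := by
  induction hf with
  | of hf hn => exact h _ _ hf hn
  | zero n => exact .zero n
  | add _ _ hf hg => exact .add hf hg
  | smul c _ hf => exact .smul c hf
  | comp_left _ hg hi hf => exact .comp_left hf hg hi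
  | comp_right hf _ hi hg => exact .comp_right hf hg hi

theorem operadIdeal_eq_of {S T : Set (FreeOp k)}
    (h : ∀ n, ∀ f ∈ S, f ∈ component k n → InIdeal T n f)
    (h' : ∀ n, ∀ f ∈ T, f ∈ component k n → InIdeal S n f) : operadIdeal S = operadIdeal T := by
  funext n
  ext f
  exact ⟨InIdeal.trans h, InIdeal.trans h'⟩

/-! ### Evaluation of tree monomials -/

/-- The multiplication used to evaluate an operation. -/
def opMul (k : Type*) [Field k] : Op → (FreeOp k →ₗ[k] FreeOp k →ₗ[k] FreeOp k)
  | .x => nodeMul k .x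
  | .y => ymul k

/-- Evaluation of a tree at elements `v 0, v 1, …` substituted at its leaves. -/
def evalTree : Tree → (ℕ → FreeOp k) → FreeOp k
  | .leaf, v => v 0
  | .node o l r, v => opMul k o (evalTree l v) (evalTree r fun j => v (j + l.arity))

/-- The linear extension of `evalTree`. -/
def eval (v : ℕ → FreeOp k) : FreeOp k →ₗ[k] FreeOp k :=
  Finsupp.linearCombination k fun t => evalTree t v

@[simp]
theorem eval_mon (v : ℕ → FreeOp k) (t : Tree) : eval v (mon k t) = evalTree t v := by
  simp [eval, mon]

theorem evalTree_congr (t : Tree) {v w : ℕ → FreeOp k} (h : ∀ j < t.arity, v j = w j) :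
    evalTree t v = evalTree t w := by
  induction t generalizing v w with
  | leaf => exact h 0 (by simp [Tree.arity])
  | node o l r hl hr =>
    simp only [Tree.arity] at h
    simp only [evalTree]
    rw [hl fun j hj => h j (by omega), hr fun j hj => h (j + l.arity) (by omega)]

/-- Grafting is substitution: leaf `i` of `s` receives the value of `t`, and the leaves after it
read their variables `t.arity - 1` places further on. -/
theorem evalTree_graft (s t : Tree) {i : ℕ} (hi : i < s.arity) (v : ℕ → FreeOp k) :
    evalTree (s.graft i t) v = evalTree s (Function.update
      (fun j => if j < i then v j else v (j + t.arity - 1)) i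
      (evalTree t fun j => v (j + i))) := by
  have ht := t.arity_pos
  induction s generalizing i v with
  | leaf =>
    obtain rfl : i = 0 := by simpa [Tree.arity] using hi
    simp [Tree.graft, evalTree]
  | node o l r hl hr =>
    simp only [Tree.arity] at hi
    rw [Tree.graft]
    split_ifs with h
    · simp only [evalTree]
      rw [hl h, Tree.arity_graft _ _ h]
      congr 1
      refine evalTree_congr _ fun j _ => ?_
      rw [Function.update_of_ne (by omega), if_neg (by omega)]
      congr 1; omega
    · simp only [evalTree]
      rw [hr (by omega)]
      congr 1
      · congr 1
        refine evalTree_congr _ fun j _ => ?_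
        rw [Function.update_of_ne (by omega), if_pos (by omega)]
      · congr 1
        funext j
        by_cases hj : j = i - l.arity
        · subst hj
          rw [Function.update_self, show i - l.arity + l.arity = i by omega, Function.update_self]
          congr 1
          funext j
          congr 1; omega
        · rw [Function.update_of_ne hj, Function.update_of_ne (by omega)]
          split_ifs <;> first | omega | (congr 1; omega) | rfl

/-- Evaluation is linear in the element substituted at a leaf. -/
theorem exists_linear_evalTree (s : Tree) {i : ℕ} (hi : i < s.arity) (v : ℕ → FreeOp k) :
    ∃ L : FreeOp k →ₗ[k] FreeOp k, ∀ z, evalTree s (Function.update v i z) = L z := by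
  induction s generalizing i v with
  | leaf =>
    obtain rfl : i = 0 := by simpa [Tree.arity] using hi
    exact ⟨LinearMap.id, fun z => by simp [evalTree]⟩
  | node o l r hl hr =>
    simp only [Tree.arity] at hi
    by_cases h : i < l.arity
    · obtain ⟨L, hL⟩ := hl h v
      refine ⟨(opMul k o).flip (evalTree r fun j => v (j + l.arity)) ∘ₗ L, fun z => ?_⟩
      simp only [evalTree, hL, LinearMap.comp_apply, LinearMap.flip_apply]
      congr 1
      exact evalTree_congr _ fun j _ => Function.update_of_ne (by omega) _ _
    · obtain ⟨L, hL⟩ := hr (i := i - l.arity) (by omega) fun j => v (j + l.arity)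
      refine ⟨opMul k o (evalTree l v) ∘ₗ L, fun z => ?_⟩
      simp only [evalTree, ← hL, LinearMap.comp_apply]
      congr 1
      · congr 1
        exact evalTree_congr _ fun j _ => Function.update_of_ne (by omega) _ _
      · congr 1
        funext j
        by_cases hj : j = i - l.arity
        · subst hj
          rw [Function.update_self, show i - l.arity + l.arity = i by omega, Function.update_self]
        · rw [Function.update_of_ne hj, Function.update_of_ne (by omega)]

theorem eval_comp (v : ℕ → FreeOp k) (i : ℕ) (f g : FreeOp k) :
    eval v (comp i f g) =
      f.sum fun s a => g.sum fun t b => (a * b) • evalTree (s.graft i t) v := by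
  simp only [comp, eval, Finsupp.sum, map_sum, Finsupp.linearCombination_single]

theorem eval_eq_sum (v : ℕ → FreeOp k) (f : FreeOp k) :
    eval v f = f.sum fun s a => a • evalTree s v := rfl

/-- Evaluation kills the operadic ideal generated by elements that it kills. -/
theorem eval_eq_zero_of_inIdeal {S : Set (FreeOp k)} (hS : ∀ f ∈ S, ∀ v, eval v f = 0) {n : ℕ}
    {f : FreeOp k} (hf : InIdeal S n f) : ∀ v, eval v f = 0 := by
  induction hf with
  | of hf _ => exact hS _ hf
  | zero => simp
  | add _ _ hf hg => intro v; rw [map_add, hf, hg, add_zero]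
  | smul c _ hf => intro v; rw [map_smul, hf, smul_zero]
  | @comp_left m n i f g hfI hg hi hf =>
    intro v
    -- For a fixed `t`, the sum over `s` is the evaluation of `f` at one valuation depending on `t`;
    -- this is why the induction ranges over all `v`.
    rw [eval_comp, Finsupp.sum_comm]
    refine Finset.sum_eq_zero fun t _ => ?_
    have := hf (Function.update (fun j => if j < i then v j else v (j + t.arity - 1)) i
      (evalTree t fun j => v (j + i)))
    rw [eval_eq_sum] at this
    rw [← smul_zero (g t), ← this, Finsupp.sum, Finset.smul_sum]
    refine Finset.sum_congr rfl fun s hs => ?_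
    beta_reduce
    rw [evalTree_graft, smul_smul, mul_comm]
    rwa [mem_component.1 hfI.mem_component s hs]
  | @comp_right m n i f g hf hgI hi hg =>
    intro v
    rw [eval_comp]
    refine Finset.sum_eq_zero fun s hs => ?_
    have hs' : i < s.arity := by rwa [mem_component.1 hf s hs]
    -- By homogeneity every `t` in `g` has arity `n`, so the valuation outside leaf `i`, and with it
    -- `L`, is the same for all `t`.
    obtain ⟨L, hL⟩ := exists_linear_evalTree s hs'
      fun j => if j < i then v j else v (j + n - 1)
    have := congrArg L (hg fun j => v (j + i))
    rw [eval_eq_sum, Finsupp.sum, map_sum, map_zero] at this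
    rw [← smul_zero (f s), ← this, Finset.smul_sum]
    refine Finset.sum_congr rfl fun t ht => ?_
    beta_reduce
    rw [evalTree_graft _ _ hs', map_smul, smul_smul, ← hL,
      mem_component.1 hgI.mem_component t ht]

theorem eval_rule₁ (v : ℕ → FreeOp k) : eval v (rule₁ k) = 0 := by
  simp only [rule₁, lead₁, map_sub, map_add, eval_mon, evalTree, opMul, Tree.arity, zero_add,
    Nat.reduceAdd, ymul_ymul]
  abel

/-! ### The second rule follows from the first -/

/-- The first two terms are the S-polynomial of the self-overlap `y(*,y(*,y(*,*)))`; the other three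
reduce it by rule (1). -/
theorem rule₂_eq : rule₂ k =
    comp 2 (rule₁ k) (mon k (node .y leaf leaf)) - comp 1 (mon k (node .y leaf leaf)) (rule₁ k)
      - comp 1 (rule₁ k) (mon k (node .y leaf leaf))
      + comp 0 (rule₁ k) (mon k (node .y leaf leaf))
      - comp 0 (mon k (node .y leaf leaf)) (rule₁ k) := by
  simp only [rule₁, rule₂, lead₁, lead₂, compLin_apply, map_sub, map_add, LinearMap.sub_apply,
    LinearMap.add_apply]
  simp only [← compLin_apply, comp_mon, Tree.graft, Tree.arity]
  simp
  abel

theorem rule₁_mem_component : rule₁ k ∈ component k 3 := by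
  refine sub_mem ?_ (sub_mem (add_mem ?_ ?_) ?_) <;> exact mon_mem_component _

theorem rule₂_mem_component : rule₂ k ∈ component k 4 := by
  refine sub_mem ?_ (sub_mem (add_mem (add_mem (sub_mem (add_mem (sub_mem (sub_mem (add_mem ?_ ?_)
    ?_) ?_) ?_) ?_) ?_) ?_) ?_) <;> exact mon_mem_component _

theorem inIdeal_rule₂ : InIdeal {rule₁ k} 4 (rule₂ k) := by
  have h : InIdeal {rule₁ k} 3 (rule₁ k) := .of rfl rule₁_mem_component
  have hy : mon k (node .y leaf leaf) ∈ component k 2 := mon_mem_component _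
  rw [rule₂_eq]
  exact .sub (.add (.sub (.sub (.comp_left h hy (by norm_num)) (.comp_right hy h (by norm_num)))
    (.comp_left h hy (by norm_num))) (.comp_left h hy (by norm_num)))
    (.comp_right hy h (by norm_num))

/-! ### Rewriting and monomial orders -/

/-- The span of the tree monomials that are at most `t`. -/
def below (k : Type*) [Field k] (lt : Tree → Tree → Prop) (t : Tree) : Submodule k (FreeOp k) :=
  Finsupp.supported k k {s : Tree | s = t ∨ lt s t}

section Below

variable {lt : Tree → Tree → Prop}

theorem mon_mem_below {s t : Tree} (h : s = t ∨ lt s t) : mon k s ∈ below k lt t :=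
  Finsupp.single_mem_supported k 1 h

theorem map_mem_of_mem_below {t : Tree} {f : FreeOp k} (hf : f ∈ below k lt t)
    (L : FreeOp k →ₗ[k] FreeOp k) (p : Submodule k (FreeOp k))
    (h : ∀ s, s = t ∨ lt s t → L (mon k s) ∈ p) : L f ∈ p := by
  rw [below, Finsupp.supported_eq_span_single] at hf
  have : Submodule.span k ((fun i => Finsupp.single i 1) '' {s : Tree | s = t ∨ lt s t}) ≤
      p.comap L := by
    rw [Submodule.span_le]
    rintro _ ⟨s, hs, rfl⟩
    exact h s hs
  exact this hf

theorem IsMonomialOrder.below_mono (hlt : IsMonomialOrder lt) {s t : Tree} (h : s = t ∨ lt s t) :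
    below k lt s ≤ below k lt t := by
  refine Finsupp.supported_mono fun u hu => ?_
  rcases h with rfl | h
  · exact hu
  · rcases hu with rfl | hu
    · exact Or.inr h
    · exact Or.inr (hlt.trans hu h)

theorem IsMonomialOrder.node_le (hlt : IsMonomialOrder lt) (o : Op) {a b l r : Tree}
    (hl : a = l ∨ lt a l) (hr : b = r ∨ lt b r) :
    node o a b = node o l r ∨ lt (node o a b) (node o l r) := by
  have h1 : a = l ∨ lt (node o a b) (node o l b) := hl.imp_right fun h => by
    simpa [Tree.graft, Tree.arity] using
      hlt.graft_right (node o leaf b) 0 (by simp [Tree.arity]) h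
  have h2 : b = r ∨ lt (node o l b) (node o l r) := hr.imp_right fun h => by
    simpa [Tree.graft, Tree.arity] using
      hlt.graft_right (node o l leaf) l.arity (by simp [Tree.arity]) h
  rcases h1 with rfl | h1 <;> rcases h2 with rfl | h2
  · exact Or.inl rfl
  · exact Or.inr h2
  · exact Or.inr h1
  · exact Or.inr (hlt.trans h1 h2)

theorem IsMonomialOrder.nodeMul_mem_below (hlt : IsMonomialOrder lt) (o : Op) {l r : Tree}
    {f g : FreeOp k} (hf : f ∈ below k lt l) (hg : g ∈ below k lt r) :
    nodeMul k o f g ∈ below k lt (node o l r) := by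
  refine map_mem_of_mem_below hg _ _ fun b hb => ?_
  rw [← LinearMap.flip_apply]
  refine map_mem_of_mem_below hf _ _ fun a ha => ?_
  rw [LinearMap.flip_apply, nodeMul_mon]
  exact mon_mem_below (hlt.node_le o ha hb)

/-- Grafting from the last leaf to the first leaves the numbers of the remaining leaves unchanged.
-/
theorem IsMonomialOrder.graft_three_lt (hlt : IsMonomialOrder lt) {s t : Tree} (h : lt s t)
    (hs : s.arity = 3) (a b c : Tree) :
    lt (((s.graft 2 c).graft 1 b).graft 0 a) (((t.graft 2 c).graft 1 b).graft 0 a) := by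
  have hc := hlt.graft_left 2 c (by omega) h
  have h2 := Tree.arity_graft s c (i := 2) (by omega)
  have := c.arity_pos
  have hb := hlt.graft_left 1 b (by omega) hc
  exact hlt.graft_left 0 a (Tree.arity_pos _) hb

theorem IsMonomialOrder.graft_four_lt (hlt : IsMonomialOrder lt) {s t : Tree} (h : lt s t)
    (hs : s.arity = 4) (a b c d : Tree) :
    lt ((((s.graft 3 d).graft 2 c).graft 1 b).graft 0 a)
      ((((t.graft 3 d).graft 2 c).graft 1 b).graft 0 a) := by
  have hd := hlt.graft_left 3 d (by omega) h
  have h3 := Tree.arity_graft s d (i := 3) (by omega)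
  have := d.arity_pos
  have hc := hlt.graft_left 2 c (by omega) hd
  have h2 := Tree.arity_graft (s.graft 3 d) c (i := 2) (by omega)
  have := c.arity_pos
  have hb := hlt.graft_left 1 b (by omega) hc
  exact hlt.graft_left 0 a (Tree.arity_pos _) hb

/-- The rewritten product does not exceed the plain one. -/
theorem IsMonomialOrder.ymul_mon_mem_below (hlt : IsMonomialOrder lt)
    (h₁ : IsLeading lt (rule₁ k) lead₁) (h₂ : IsLeading lt (rule₂ k) lead₂) (n : ℕ) :
    ∀ r : Tree, r.weight = n → ∀ (l : Tree) (f : FreeOp k), f ∈ below k lt l →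
      ymul k f (mon k r) ∈ below k lt (node .y l r) := by
  induction n using Nat.strong_induction_on with
  | _ n ih =>
  intro r hr l f hf
  have hm (t : Tree) : mon k t ∈ below k lt t := mon_mem_below (Or.inl rfl)
  by_cases hI : r.Inert
  · rw [ymul_eq_nodeMul hI]
    exact hlt.nodeMul_mem_below _ hf (hm r)
  match r, hr with
  | .leaf, _ => exact absurd rfl hI
  | .node .x d .leaf, _ => exact absurd rfl hI
  | .node .x d (.node .y e f), _ => exact absurd rfl hI
  | .node .y b c, hr =>
    simp only [Tree.weight] at hr
    have hb := b.weight_pos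
    have hc := c.weight_pos
    have ihb := ih b.weight (by omega) b rfl
    have ihc := ih c.weight (by omega) c rfl
    -- Each term on the right of the rule is below the left-hand side, and stays so after `l`, `b`,
    -- `c` are substituted.
    have key (s : Tree) (hs : s ∈ (rule₁ k).support ∧ s ≠ lead₁ ∧ s.arity = 3) :=
      hlt.graft_three_lt (h₁.2 s hs.1 hs.2.1) hs.2.2 l b c
    have k1 := key (node .x leaf (node .x leaf leaf))
      (by simp [rule₁, mon, lead₁, Tree.arity])
    have k2 := key (node .y (node .y leaf leaf) leaf)
      (by simp [rule₁, mon, lead₁, Tree.arity])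
    have k3 := key (node .x (node .x leaf leaf) leaf)
      (by simp [rule₁, mon, lead₁, Tree.arity])
    simp [lead₁, Tree.graft, Tree.arity] at k1 k2 k3
    rw [ymul_y_mon _ _ (by simpa [Tree.Inert] using hI)]
    refine sub_mem (add_mem ?_ ?_) ?_
    · exact hlt.below_mono (Or.inr k1)
        (hlt.nodeMul_mem_below _ hf (hlt.nodeMul_mem_below _ (hm b) (hm c)))
    · exact hlt.below_mono (Or.inr k2) (ihc _ _ (ihb _ _ hf))
    · exact hlt.below_mono (Or.inr k3)
        (hlt.nodeMul_mem_below _ (hlt.nodeMul_mem_below _ hf (hm b)) (hm c))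
  | .node .x b (.node .x c d), hr =>
    simp only [Tree.weight] at hr
    have hb := b.weight_pos
    have hc := c.weight_pos
    have hd := d.weight_pos
    have ihb := ih b.weight (by omega) b rfl
    have ihc := ih c.weight (by omega) c rfl
    have ihd := ih d.weight (by omega) d rfl
    have ihx := ih _ (by simp only [Tree.weight]; omega) (node .x (node .x b c) d) rfl
    have key (s : Tree) (hs : s ∈ (rule₂ k).support ∧ s ≠ lead₂ ∧ s.arity = 4) :=
      hlt.graft_four_lt (h₂.2 s hs.1 hs.2.1) hs.2.2 l b c d
    have k1 := key (node .y leaf (node .x (node .x leaf leaf) leaf))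
      (by simp [rule₂, mon, lead₂, Tree.arity])
    have k2 := key (node .x leaf (node .x leaf (node .y leaf leaf)))
      (by simp [rule₂, mon, lead₂, Tree.arity])
    have k3 := key (node .x leaf (node .x (node .y leaf leaf) leaf))
      (by simp [rule₂, mon, lead₂, Tree.arity])
    have k4 := key (node .y (node .x leaf (node .x leaf leaf)) leaf)
      (by simp [rule₂, mon, lead₂, Tree.arity])
    have k5 := key (node .x (node .y leaf leaf) (node .x leaf leaf))
      (by simp [rule₂, mon, lead₂, Tree.arity])
    have k6 := key (node .x (node .x leaf leaf) (node .y leaf leaf))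
      (by simp [rule₂, mon, lead₂, Tree.arity])
    have k7 := key (node .x (node .x leaf (node .y leaf leaf)) leaf)
      (by simp [rule₂, mon, lead₂, Tree.arity])
    have k8 := key (node .y (node .x (node .x leaf leaf) leaf) leaf)
      (by simp [rule₂, mon, lead₂, Tree.arity])
    have k9 := key (node .x (node .x (node .y leaf leaf) leaf) leaf)
      (by simp [rule₂, mon, lead₂, Tree.arity])
    simp [lead₂, Tree.graft, Tree.arity, show 1 < 2 + c.arity by have := c.arity_pos; omega]
      at k1 k2 k3 k4 k5 k6 k7 k8 k9
    have hx {l r : Tree} {f g : FreeOp k} (hf : f ∈ below k lt l) (hg : g ∈ below k lt r) :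
      nodeMul k .x f g ∈ below k lt (node .x l r) := hlt.nodeMul_mem_below _ hf hg
    rw [← nodeMul_mon, ← nodeMul_mon, ymul_x_x]
    refine sub_mem (add_mem (add_mem (sub_mem (add_mem (sub_mem (sub_mem (add_mem ?_ ?_)
      ?_) ?_) ?_) ?_) ?_) ?_) ?_
    · rw [nodeMul_mon, nodeMul_mon]
      exact hlt.below_mono (Or.inr k1) (ihx _ _ hf)
    · exact hlt.below_mono (Or.inr k2) (hx hf (hx (hm b) (ihd _ _ (hm c))))
    · exact hlt.below_mono (Or.inr k3) (hx hf (hx (ihc _ _ (hm b)) (hm d)))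
    · exact hlt.below_mono (Or.inr k4) (ihd _ _ (hx hf (hx (hm b) (hm c))))
    · exact hlt.below_mono (Or.inr k5) (hx (ihb _ _ hf) (hx (hm c) (hm d)))
    · exact hlt.below_mono (Or.inr k6) (hx (hx hf (hm b)) (ihd _ _ (hm c)))
    · exact hlt.below_mono (Or.inr k7) (hx (hx hf (ihc _ _ (hm b))) (hm d))
    · exact hlt.below_mono (Or.inr k8) (ihd _ _ (hx (hx hf (hm b)) (hm c)))
    · exact hlt.below_mono (Or.inr k9) (hx (hx (ihb _ _ hf) (hm c)) (hm d))

theorem IsMonomialOrder.ymul_mem_below (hlt : IsMonomialOrder lt)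
    (h₁ : IsLeading lt (rule₁ k) lead₁) (h₂ : IsLeading lt (rule₂ k) lead₂) {l r : Tree}
    {f g : FreeOp k} (hf : f ∈ below k lt l) (hg : g ∈ below k lt r) :
    ymul k f g ∈ below k lt (node .y l r) :=
  map_mem_of_mem_below hg _ _ fun b hb => hlt.below_mono (hlt.node_le .y (Or.inl rfl) hb)
    (hlt.ymul_mon_mem_below h₁ h₂ _ b rfl l f hf)

/-- The normal form of a tree monomial does not exceed it. -/
theorem IsMonomialOrder.evalTree_mem_below (hlt : IsMonomialOrder lt)
    (h₁ : IsLeading lt (rule₁ k) lead₁) (h₂ : IsLeading lt (rule₂ k) lead₂) (t : Tree) :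
    evalTree t (fun _ => mon k leaf) ∈ below k lt t := by
  induction t with
  | leaf => exact mon_mem_below (Or.inl rfl)
  | node o l r hl hr =>
    cases o
    · exact hlt.nodeMul_mem_below _ hl hr
    · exact hlt.ymul_mem_below h₁ h₂ hl hr

/-- Tree monomials that no rule applies to are their own normal forms. -/
theorem evalTree_eq_mon {t : Tree} (h₁ : ¬ lead₁.Divides t) (h₂ : ¬ lead₂.Divides t) :
    evalTree t (fun _ => mon k leaf) = mon k t := by
  induction t with
  | leaf => rfl
  | node o l r hl hr =>
    simp only [Tree.Divides, not_or] at h₁ h₂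
    simp only [evalTree]
    rw [hl h₁.2.1 h₂.2.1, hr h₁.2.2 h₂.2.2]
    cases o with
    | x => exact nodeMul_mon _ _ _
    | y =>
      suffices hI : r.Inert by
        rw [opMul, ymul_eq_nodeMul hI, nodeMul_mon]
      match r, h₁.1, h₂.1 with
      | .leaf, _, _ => rfl
      | .node .x d .leaf, _, _ => rfl
      | .node .x d (.node .y e f), _, _ => rfl
      | .node .y d e, h, _ => simp [lead₁, Tree.MatchRoot] at h
      | .node .x d (.node .x e f), _, h => simp [lead₂, Tree.MatchRoot] at h

theorem IsMonomialOrder.exists_isLeading (hlt : IsMonomialOrder lt) {n : ℕ} {f : FreeOp k}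
    (hf : f ∈ component k n) (h0 : f ≠ 0) : ∃ t, IsLeading lt f t := by
  have hne : f.support.Nonempty := Finsupp.support_nonempty_iff.2 h0
  have : IsStrictOrder Tree lt :=
    { irrefl := hlt.irrefl, trans := fun _ _ _ => hlt.trans }
  obtain ⟨t, ht, hmax⟩ := f.support.finite_toSet.wellFoundedOn (r := Function.swap lt)
    |>.has_min (s := Set.univ) ⟨⟨hne.choose, hne.choose_spec⟩, trivial⟩
  refine ⟨t, t.2, fun s hs hst => ?_⟩
  have har : s.arity = (t : Tree).arity := by
    rw [mem_component.1 hf s hs, mem_component.1 hf t t.2]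
  exact (hlt.total har hst).resolve_right (hmax ⟨s, hs⟩ trivial)

/-- The leading monomial of an element of the ideal of the first rule is divisible by the leading
monomial of one of the two rules. -/
theorem IsMonomialOrder.lead_divides (hlt : IsMonomialOrder lt)
    (h₁ : IsLeading lt (rule₁ k) lead₁) (h₂ : IsLeading lt (rule₂ k) lead₂) {n : ℕ}
    {f : FreeOp k} (hf : InIdeal {rule₁ k} n f) {t : Tree} (ht : IsLeading lt f t) :
    lead₁.Divides t ∨ lead₂.Divides t := by
  by_contra! h
  have h0 := eval_eq_zero_of_inIdeal
    (by rintro _ rfl; exact eval_rule₁) hf fun _ => mon k leaf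
  have h0t := DFunLike.congr_fun h0 t
  -- The coefficient of `t` in the evaluation comes from `t` alone: every other `s` in `f` is
  -- smaller and evaluates to trees at most `s`.
  rw [eval_eq_sum, Finsupp.sum, Finsupp.finsetSum_apply, Finset.sum_eq_single t] at h0t
  · rw [evalTree_eq_mon h.1 h.2] at h0t
    simp [mon] at h0t
    exact Finsupp.mem_support_iff.1 ht.1 h0t
  · intro s hs hst
    have hst' := ht.2 s hs hst
    have hN := hlt.evalTree_mem_below h₁ h₂ s
    rw [below, Finsupp.mem_supported'] at hN
    rw [Finsupp.smul_apply, hN t, smul_zero]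
    rintro (rfl | h')
    · exact hst rfl
    · exact hlt.irrefl _ (hlt.trans h' hst')
  · exact fun h => absurd ht.1 h

theorem IsMonomialOrder.isGroebnerBasis (hlt : IsMonomialOrder lt)
    (h₁ : IsLeading lt (rule₁ k) lead₁) (h₂ : IsLeading lt (rule₂ k) lead₂) :
    IsGroebnerBasis lt {rule₁ k, rule₂ k} (operadIdeal {rule₁ k}) where
  homogeneous := by
    rintro _ (rfl | rfl)
    · exact ⟨3, rule₁_mem_component⟩
    · exact ⟨4, rule₂_mem_component⟩
  generates := by
    refine operadIdeal_eq_of ?_ ?_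
    · rintro n _ (rfl | rfl) hn
      · exact .of rfl hn
      · obtain rfl : 4 = n := by
          rw [← mem_component.1 hn _ h₂.1]; rfl
        exact inIdeal_rule₂
    · rintro n _ rfl hn
      exact .of (Or.inl rfl) hn
  leading n f hf h0 := by
    obtain ⟨t, ht⟩ := hlt.exists_isLeading (InIdeal.mem_component hf) h0
    rcases hlt.lead_divides h₁ h₂ hf ht with h | h
    · exact ⟨_, Or.inl rfl, _, t, h₁, ht, h⟩
    · exact ⟨_, Or.inr rfl, _, t, h₂, ht, h⟩

end Below

/-! ### The path order from right to left -/

/-- The digit of an operation in path codes. -/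
def Op.digit : Op → ℕ
  | .x => 0
  | .y => 1

theorem Op.digit_lt (o : Op) : o.digit < 2 := by cases o <;> simp [Op.digit]

theorem Op.digit_injective : Function.Injective Op.digit := by
  rintro (_ | _) (_ | _) h <;> simp_all [Op.digit]

/-- The path from the root to the leaf number `j`, as binary digits appended to the number `a`.
With `a = 1` the order of these numbers is the degree-lexicographic order of the paths. -/
def Tree.path : Tree → ℕ → ℕ → ℕ
  | .leaf, _, a => a
  | .node o l r, j, a =>
      if j < l.arity then l.path j (2 * a + o.digit) else r.path (j - l.arity) (2 * a + o.digit)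

theorem Tree.exists_path_eq (t : Tree) (j : ℕ) :
    ∃ e v, v < 2 ^ e ∧ ∀ a, t.path j a = a * 2 ^ e + v := by
  induction t generalizing j with
  | leaf => exact ⟨0, 0, by simp, fun a => by simp [Tree.path]⟩
  | node o l r hl hr =>
    have key : ∀ (p : ℕ → ℕ) (e v : ℕ), v < 2 ^ e → (∀ a, p a = a * 2 ^ e + v) →
        ∃ e v, v < 2 ^ e ∧ ∀ a, p (2 * a + o.digit) = a * 2 ^ e + v := by
      intro p e v hv hp
      refine ⟨e + 1, o.digit * 2 ^ e + v, ?_, fun a => by rw [hp]; ring⟩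
      have := Nat.mul_le_mul_right (2 ^ e) (Nat.le_of_lt_succ o.digit_lt)
      rw [pow_succ]; omega
    by_cases h : j < l.arity
    · obtain ⟨e, v, hv, hp⟩ := hl j
      simpa only [Tree.path, if_pos h] using key _ e v hv hp
    · obtain ⟨e, v, hv, hp⟩ := hr (j - l.arity)
      simpa only [Tree.path, if_neg h] using key _ e v hv hp

/-- After a common nonzero prefix `a`, comparing numbers means comparing the lengths `e`, `e'` of
the suffixes and then their values. -/
theorem lt_or_eq_of_path_lt {a e v e' v' : ℕ} (ha : 0 < a) (hv' : v' < 2 ^ e')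
    (h : a * 2 ^ e + v < a * 2 ^ e' + v') : e < e' ∨ e = e' ∧ v < v' := by
  rcases lt_trichotomy e e' with he | rfl | he
  · exact Or.inl he
  · exact Or.inr ⟨rfl, by omega⟩
  · exfalso
    have h1 : 2 ^ (e' + 1) ≤ 2 ^ e := Nat.pow_le_pow_right (by norm_num) he
    rw [pow_succ] at h1
    have h2 := Nat.mul_le_mul_left a h1
    have h3 := Nat.mul_le_mul_right (2 ^ e') ha
    rw [← mul_assoc] at h2
    omega

theorem path_lt_of_lt_or_eq {a e v e' v' : ℕ} (ha : 0 < a) (hv : v < 2 ^ e)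
    (h : e < e' ∨ e = e' ∧ v < v') : a * 2 ^ e + v < a * 2 ^ e' + v' := by
  rcases h with he | ⟨rfl, h⟩
  · have h1 : 2 ^ (e + 1) ≤ 2 ^ e' := Nat.pow_le_pow_right (by norm_num) he
    rw [pow_succ] at h1
    have h2 := Nat.mul_le_mul_left a h1
    have h3 := Nat.mul_le_mul_right (2 ^ e) ha
    rw [← mul_assoc] at h2
    omega
  · omega

/-- Comparison of paths does not depend on the common initial segment. -/
theorem Tree.path_lt_path {s t : Tree} {i j a b : ℕ} (ha : 0 < a) (hb : 0 < b)
    (h : s.path i a < t.path j a) : s.path i b < t.path j b := by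
  obtain ⟨e, v, hv, hp⟩ := s.exists_path_eq i
  obtain ⟨e', v', hv', hp'⟩ := t.exists_path_eq j
  rw [hp, hp'] at h ⊢
  exact path_lt_of_lt_or_eq hb hv (lt_or_eq_of_path_lt ha hv' h)

theorem Tree.path_eq_path {s t : Tree} {i j a b : ℕ} (ha : 0 < a) (hb : 0 < b)
    (h : s.path i a = t.path j a) : s.path i b = t.path j b := by
  rcases lt_trichotomy (s.path i b) (t.path j b) with h' | h' | h'
  · exact absurd h (Tree.path_lt_path hb ha h').ne
  · exact h'
  · exact absurd h (Tree.path_lt_path hb ha h').ne'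

theorem Tree.path_strictMono (t : Tree) (j : ℕ) : StrictMono (t.path j) := by
  intro a b hab
  obtain ⟨e, v, hv, hp⟩ := t.exists_path_eq j
  rw [hp, hp]
  have := Nat.mul_lt_mul_of_pos_right hab (Nat.two_pow_pos e)
  omega

theorem Tree.path_pos (t : Tree) (j : ℕ) {a : ℕ} (ha : 0 < a) : 0 < t.path j a :=
  lt_of_le_of_lt (Nat.zero_le _) (t.path_strictMono j ha)

/-- The path to a leaf of the grafted `t` is the path to leaf `i` of `s` continued in `t`; other
paths are those of `s`, renumbered. -/
theorem Tree.path_graft (s t : Tree) {i : ℕ} (hi : i < s.arity) {j : ℕ}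
    (hj : j < (s.graft i t).arity) (a : ℕ) :
    (s.graft i t).path j a =
      if j < i then s.path j a
      else if j < i + t.arity then t.path (j - i) (s.path i a)
      else s.path (j + 1 - t.arity) a := by
  have ht := t.arity_pos
  rw [Tree.arity_graft s t hi] at hj
  induction s generalizing i j a with
  | leaf =>
    obtain rfl : i = 0 := by simpa [Tree.arity] using hi
    simp only [Tree.arity] at hj
    rw [if_neg (by omega), if_pos (by omega)]
    rfl
  | node o l r hl hr =>
    simp only [Tree.arity] at hi hj
    rw [Tree.graft]
    by_cases h : i < l.arity
    · have hcard := Tree.arity_graft l t h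
      simp only [if_pos h, Tree.path]
      by_cases hjl : j < (l.graft i t).arity
      · rw [if_pos hjl, hl h (by omega)]
        split_ifs <;> first | rfl | omega
      · rw [if_neg hjl, if_neg (by omega), if_neg (by omega), if_neg (by omega)]
        congr 1; omega
    · simp only [if_neg h, Tree.path]
      by_cases hjl : j < l.arity
      · rw [if_pos hjl, if_pos (by omega), if_pos hjl]
      · rw [if_neg hjl, hr (i := i - l.arity) (by omega) (by omega)]
        split_ifs <;> first | rfl | omega | (congr 1; omega)

/-- The first digit of a path and the rest of it can be read off. -/
theorem digit_eq_and_path_eq {s t : Tree} {i j : ℕ} {o o' : Op}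
    (h : s.path i (2 * 1 + o.digit) = t.path j (2 * 1 + o'.digit)) :
    o = o' ∧ s.path i 1 = t.path j 1 := by
  obtain ⟨e, v, hv, hp⟩ := s.exists_path_eq i
  obtain ⟨e', v', hv', hp'⟩ := t.exists_path_eq j
  have ho := o.digit_lt
  have ho' := o'.digit_lt
  have key : ∀ {e v e' v' d d' : ℕ}, v < 2 ^ e → d < 2 → e < e' →
      (2 * 1 + d) * 2 ^ e + v < (2 * 1 + d') * 2 ^ e' + v' := by
    intro e v e' v' d d' hv hd he
    have h1 : 2 ^ (e + 1) ≤ 2 ^ e' := Nat.pow_le_pow_right (by norm_num) he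
    rw [pow_succ] at h1
    have h2 := Nat.mul_le_mul_right (2 ^ e) (show 2 * 1 + d ≤ 3 by omega)
    have h3 := Nat.mul_le_mul_right (2 ^ e') (show 2 ≤ 2 * 1 + d' by omega)
    omega
  rw [hp, hp'] at h
  rcases lt_trichotomy e e' with he | rfl | he
  · exact absurd h (key hv ho he).ne
  · have hd : o.digit = o'.digit := by
      rcases lt_trichotomy o.digit o'.digit with hd | hd | hd
      · have := Nat.mul_le_mul_right (2 ^ e) (show 2 * 1 + o.digit + 1 ≤ 2 * 1 + o'.digit by omega)
        rw [add_mul _ 1] at this; omega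
      · exact hd
      · have := Nat.mul_le_mul_right (2 ^ e) (show 2 * 1 + o'.digit + 1 ≤ 2 * 1 + o.digit by omega)
        rw [add_mul _ 1] at this; omega
    obtain rfl := Op.digit_injective hd
    exact ⟨rfl, by rw [hp, hp']; omega⟩
  · exact absurd h (key hv' ho' he).ne'

/-- A tree is determined by its paths. -/
theorem Tree.eq_of_path_eq (n : ℕ) : ∀ s t : Tree, s.arity ≤ n → s.arity ≤ t.arity →
    (∀ j < s.arity, s.path j 1 = t.path j 1) → s = t := by
  induction n with
  | zero => exact fun s _ hs => absurd s.arity_pos (by omega)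
  | succ n ih =>
    intro s t hs hst h
    have hnode (o : Op) (l r : Tree) (j : ℕ) : 1 < (node o l r).path j 1 := by
      simp only [Tree.path]
      have hl := (l.path_strictMono j).le_apply (x := 2 * 1 + o.digit)
      have hr := (r.path_strictMono (j - l.arity)).le_apply (x := 2 * 1 + o.digit)
      split_ifs <;> omega
    match s, t with
    | .leaf, .leaf => rfl
    | .leaf, .node o l r => exact absurd (h 0 (Tree.arity_pos _)) (hnode o l r 0).ne
    | .node o l r, .leaf => exact absurd (h 0 (Tree.arity_pos _)) (hnode o l r 0).ne'
    | .node o l r, .node o' l' r' =>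
      simp only [Tree.arity] at hs hst h
      have hl := l.arity_pos
      have hr := r.arity_pos
      have hl' := l'.arity_pos
      have h0 := h 0 (by omega)
      simp only [Tree.path, if_pos hl, if_pos hl'] at h0
      obtain ⟨rfl, -⟩ := digit_eq_and_path_eq h0
      have hleft (j : ℕ) (hj : j < l.arity) (hj' : j < l'.arity) : l.path j 1 = l'.path j 1 := by
        have := h j (by omega)
        simp only [Tree.path, if_pos hj, if_pos hj'] at this
        exact (digit_eq_and_path_eq this).2
      -- It is not yet known that the left subtrees have equally many leaves. The one with fewer
      -- shares all its paths with the other, and the induction hypothesis asks no more.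
      obtain rfl : l = l' := by
        rcases le_total l.arity l'.arity with hle | hle
        · exact ih l l' (by omega) hle fun j hj => hleft j hj (by omega)
        · exact (ih l' l (by omega) hle fun j hj => (hleft j (by omega) hj).symm).symm
      congr 1
      refine ih r r' (by omega) (by omega) fun j hj => ?_
      have := h (j + l.arity) (by omega)
      simp only [Tree.path, if_neg (show ¬ j + l.arity < l.arity by omega),
        Nat.add_sub_cancel] at this
      exact (digit_eq_and_path_eq this).2

/-- The path order: paths are compared from the last leaf to the first one,
degree-lexicographically. -/
def pathLt (s t : Tree) : Prop :=
  s.arity = t.arity ∧ ∃ i < s.arity, s.path i 1 < t.path i 1 ∧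
    ∀ j, i < j → j < s.arity → s.path j 1 = t.path j 1

theorem pathLt_irrefl (t : Tree) : ¬ pathLt t t := fun ⟨_, _, _, h, _⟩ => lt_irrefl _ h

theorem pathLt_trans {s t u : Tree} : pathLt s t → pathLt t u → pathLt s u := by
  rintro ⟨hst, i, hi, hlt, heq⟩ ⟨htu, j, hj, hlt', heq'⟩
  refine ⟨hst.trans htu, ?_⟩
  rcases lt_trichotomy i j with h | rfl | h
  · exact ⟨j, by omega, by rwa [heq j h (by omega)], fun m hm hm' =>
      (heq m (by omega) hm').trans (heq' m hm (by omega))⟩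
  · exact ⟨i, hi, hlt.trans hlt', fun m hm hm' => (heq m hm hm').trans (heq' m hm (by omega))⟩
  · exact ⟨i, hi, by rwa [← heq' i h (by omega)], fun m hm hm' =>
      (heq m hm hm').trans (heq' m (by omega) (by omega))⟩

theorem pathLt_total {s t : Tree} (h : s.arity = t.arity) (hne : s ≠ t) :
    pathLt s t ∨ pathLt t s := by
  classical
  -- Here `m` counts leaves from the right, so the least `m` gives the last leaf where the paths
  -- differ.
  have hex : ∃ m, m < s.arity ∧ s.path (s.arity - 1 - m) 1 ≠ t.path (s.arity - 1 - m) 1 := by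
    by_contra! hall
    refine hne (Tree.eq_of_path_eq _ s t le_rfl h.le fun j hj => ?_)
    have := hall (s.arity - 1 - j) (by omega)
    rwa [show s.arity - 1 - (s.arity - 1 - j) = j by omega] at this
  have hspec := Nat.find_spec hex
  have hmin (j : ℕ) (hj : s.arity - 1 - Nat.find hex < j) (hj' : j < s.arity) :
      s.path j 1 = t.path j 1 := by
    have := Nat.find_min hex (m := s.arity - 1 - j) (by omega)
    rw [show s.arity - 1 - (s.arity - 1 - j) = j by omega] at this
    by_contra hne'
    exact this ⟨by omega, hne'⟩
  rcases lt_or_gt_of_ne hspec.2 with hlt | hlt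
  · exact Or.inl ⟨h, _, by omega, hlt, hmin⟩
  · exact Or.inr ⟨h.symm, _, by omega, hlt, fun j hj hj' => (hmin j hj (by omega)).symm⟩

theorem Tree.finite_arity_le (n : ℕ) : {t : Tree | t.arity ≤ n}.Finite := by
  induction n with
  | zero =>
    refine Set.Finite.subset Set.finite_empty fun t ht => ?_
    have := t.arity_pos
    simp only [Set.mem_ofPred_eq] at ht
    omega
  | succ n ih =>
    refine (((Set.finite_singleton leaf).union ((ih.prod ih).image fun p => node .x p.1 p.2)).union
      ((ih.prod ih).image fun p => node .y p.1 p.2)).subset fun t ht => ?_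
    match t with
    | .leaf => exact Or.inl (Or.inl rfl)
    | .node o l r =>
      simp only [Set.mem_ofPred_eq, Tree.arity] at ht
      have hl := l.arity_pos
      have hr := r.arity_pos
      have hmem : (l, r) ∈ {t : Tree | t.arity ≤ n} ×ˢ {t : Tree | t.arity ≤ n} :=
        ⟨show l.arity ≤ n by omega, show r.arity ≤ n by omega⟩
      cases o
      · exact Or.inl (Or.inr ⟨_, hmem, rfl⟩)
      · exact Or.inr ⟨_, hmem, rfl⟩

theorem pathLt_wf : WellFounded pathLt := by
  -- There are finitely many trees of each arity, so the number of smaller trees is a strictly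
  -- decreasing rank.
  refine Subrelation.wf (r := InvImage (· < ·) fun t => {s | pathLt s t}.ncard) ?_
    (InvImage.wf _ wellFounded_lt)
  intro s t hst
  refine Set.ncard_lt_ncard ⟨fun u hu => pathLt_trans hu hst, fun h => ?_⟩
    ((Tree.finite_arity_le t.arity).subset fun u hu => hu.1.le)
  exact pathLt_irrefl s (h hst)

theorem isMonomialOrder_pathLt : IsMonomialOrder pathLt where
  arity_eq h := h.1
  irrefl := pathLt_irrefl
  trans := pathLt_trans
  total := pathLt_total
  wf := pathLt_wf
  graft_left := by
    rintro s s' i t hi ⟨har, m, hm, hlt, heq⟩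
    have ht := t.arity_pos
    have hi' : i < s'.arity := by omega
    have hcard := Tree.arity_graft s t hi
    have hcard' := Tree.arity_graft s' t hi'
    -- The deciding leaf `m` is renumbered; if `m = i`, the new deciding leaf is the last leaf of
    -- the grafted `t`.
    refine ⟨by omega, if m < i then m else m + t.arity - 1, by split_ifs <;> omega, ?_, ?_⟩
    · have hm' : (if m < i then m else m + t.arity - 1) < (s.graft i t).arity := by
        split_ifs <;> omega
      rw [Tree.path_graft _ _ hi hm', Tree.path_graft _ _ hi' (by omega)]
      rcases lt_trichotomy m i with h | rfl | h
      · simpa only [if_pos h] using hlt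
      · simp only [lt_irrefl, if_false, show ¬ m + t.arity - 1 < m by omega,
          show m + t.arity - 1 < m + t.arity by omega, if_true]
        exact t.path_strictMono _ hlt
      · simp only [show ¬ m < i by omega, if_false, show ¬ m + t.arity - 1 < i by omega,
          show ¬ m + t.arity - 1 < i + t.arity by omega,
          show m + t.arity - 1 + 1 - t.arity = m by omega]
        exact hlt
    · intro j hj hj'
      rw [Tree.path_graft _ _ hi (by omega), Tree.path_graft _ _ hi' (by omega)]
      split_ifs at hj ⊢
      · exact heq j (by omega) (by omega)
      · omega
      · rw [heq i (by omega) hi]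
      · rw [heq i (by omega) hi]
      · exact heq _ (by omega) (by omega)
      · exact heq _ (by omega) (by omega)
  graft_right := by
    rintro s i t t' hi ⟨har, m, hm, hlt, heq⟩
    have hcard := Tree.arity_graft s t hi
    have hcard' := Tree.arity_graft s t' hi
    have hpos := s.path_pos i one_pos
    refine ⟨by omega, m + i, by omega, ?_, ?_⟩
    · rw [Tree.path_graft _ _ hi (by omega), Tree.path_graft _ _ hi (by omega)]
      simp only [show ¬ m + i < i by omega, if_false, show m + i < i + t.arity by omega,
        show m + i < i + t'.arity by omega, if_true, Nat.add_sub_cancel]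
      exact Tree.path_lt_path one_pos hpos hlt
    · intro j hj hj'
      rw [Tree.path_graft _ _ hi (by omega), Tree.path_graft _ _ hi (by omega), ← har]
      split_ifs
      · rfl
      · exact Tree.path_eq_path one_pos hpos (heq _ (by omega) (by omega))
      · rfl

/-- The last leaf decides: its word is `yy` in the left-hand side, against `xx`, `y` and `x`. -/
theorem isLeading_rule₁ : IsLeading pathLt (rule₁ k) lead₁ := by
  refine ⟨by simp [rule₁, mon, lead₁], fun s hs hne => ?_⟩
  suffices h : s = node .x leaf (node .x leaf leaf) ∨ s = node .y (node .y leaf leaf) leaf ∨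
      s = node .x (node .x leaf leaf) leaf by
    rcases h with rfl | rfl | rfl <;>
    exact ⟨rfl, 2, by decide, by decide, fun j hj hj' => by simp only [Tree.arity] at hj'; omega⟩
  by_contra! h
  simp [rule₁, mon, hne.symm, h.1.symm, h.2.1.symm, h.2.2.symm] at hs

/-- Again the last leaf decides: its word is `yxx`, and the only other word of length three is
`xxy`. -/
theorem isLeading_rule₂ : IsLeading pathLt (rule₂ k) lead₂ := by
  refine ⟨by simp [rule₂, mon, lead₂], fun s hs hne => ?_⟩
  suffices h : s = node .y leaf (node .x (node .x leaf leaf) leaf) ∨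
      s = node .x leaf (node .x leaf (node .y leaf leaf)) ∨
      s = node .x leaf (node .x (node .y leaf leaf) leaf) ∨
      s = node .y (node .x leaf (node .x leaf leaf)) leaf ∨
      s = node .x (node .y leaf leaf) (node .x leaf leaf) ∨
      s = node .x (node .x leaf leaf) (node .y leaf leaf) ∨
      s = node .x (node .x leaf (node .y leaf leaf)) leaf ∨
      s = node .y (node .x (node .x leaf leaf) leaf) leaf ∨
      s = node .x (node .x (node .y leaf leaf) leaf) leaf by
    rcases h with rfl | rfl | rfl | rfl | rfl | rfl | rfl | rfl | rfl <;>
    exact ⟨rfl, 3, by decide, by decide, fun j hj hj' => by simp only [Tree.arity] at hj'; omega⟩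
  by_contra! h
  obtain ⟨g1, g2, g3, g4, g5, g6, g7, g8, g9⟩ := h
  simp [rule₂, mon, hne.symm, g1.symm, g2.symm, g3.symm, g4.symm, g5.symm,
    g6.symm, g7.symm, g8.symm, g9.symm] at hs

/-! ### The relations of arity three -/

/-- The coefficient of a magma monomial. -/
def magmaCoeff (k : Type*) [Field k] (m : FreeMagma ℕ) :
    FreeNonUnitalNonAssocAlgebra k ℕ →ₗ[k] k where
  toFun g := g.coeff m
  map_add' _ _ := rfl
  map_smul' _ _ := rfl

theorem of_mul_of_mul_of (a b c : ℕ) :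
    FreeNonUnitalNonAssocAlgebra.of k a * FreeNonUnitalNonAssocAlgebra.of k b
        * FreeNonUnitalNonAssocAlgebra.of k c =
      MonoidAlgebra.single (FreeMagma.of a * FreeMagma.of b * FreeMagma.of c) 1 := by
  simp [FreeNonUnitalNonAssocAlgebra.of, MonoidAlgebra.single_mul_single]

theorem of_mul_of_mul_of' (a b c : ℕ) :
    FreeNonUnitalNonAssocAlgebra.of k a * (FreeNonUnitalNonAssocAlgebra.of k b
        * FreeNonUnitalNonAssocAlgebra.of k c) =
      MonoidAlgebra.single (FreeMagma.of a * (FreeMagma.of b * FreeMagma.of c)) 1 := by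
  simp [FreeNonUnitalNonAssocAlgebra.of, MonoidAlgebra.single_mul_single]

theorem magmaCoeff_single (m m' : FreeMagma ℕ) :
    magmaCoeff k m (MonoidAlgebra.single m' 1) = if m' = m then 1 else 0 := by
  change (MonoidAlgebra.single m' (1 : k)).coeff m = _
  simp [Finsupp.single_apply]

theorem freeMagma_mul_inj {a b c d : FreeMagma ℕ} : a * b = c * d ↔ a = c ∧ b = d :=
  ⟨fun h => by injection h; exact ⟨‹_›, ‹_›⟩, fun ⟨h, h'⟩ => h ▸ h' ▸ rfl⟩

theorem freeMagma_of_inj {a b : ℕ} : FreeMagma.of a = FreeMagma.of b ↔ a = b :=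
  ⟨fun h => by injection h, fun h => h ▸ rfl⟩

theorem freeMagma_of_ne_mul {a : ℕ} {b c : FreeMagma ℕ} : FreeMagma.of a ≠ b * c :=
  fun h => by injection h

theorem freeMagma_mul_ne_of {a : ℕ} {b c : FreeMagma ℕ} : b * c ≠ FreeMagma.of a :=
  fun h => by injection h

/-- The coefficients of an element of `flexRel k` satisfy the symmetries of the flexible law. -/
theorem magmaCoeff_flexRel {g : FreeNonUnitalNonAssocAlgebra k ℕ} (hg : g ∈ flexRel k)
    (a b c : ℕ) :
    magmaCoeff k (FreeMagma.of a * FreeMagma.of b * FreeMagma.of c) g =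
        magmaCoeff k (FreeMagma.of c * FreeMagma.of b * FreeMagma.of a) g ∧
      magmaCoeff k (FreeMagma.of a * (FreeMagma.of b * FreeMagma.of c)) g =
        - magmaCoeff k (FreeMagma.of a * FreeMagma.of b * FreeMagma.of c) g := by
  induction hg using Submodule.span_induction with
  | mem g hg =>
    obtain ⟨σ, rfl⟩ := hg
    simp only [flexLaw, of_mul_of_mul_of, of_mul_of_mul_of', map_add, map_sub, magmaCoeff_single,
      freeMagma_mul_inj, freeMagma_of_inj, freeMagma_of_ne_mul, freeMagma_mul_ne_of, and_false,
      if_false, and_assoc]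
    generalize (σ 0 : ℕ) = p, (σ 1 : ℕ) = q, (σ 2 : ℕ) = r
    have h1 : (p = c ∧ q = b ∧ r = a) ↔ (r = a ∧ q = b ∧ p = c) := by tauto
    have h2 : (r = c ∧ q = b ∧ p = a) ↔ (p = a ∧ q = b ∧ r = c) := by tauto
    simp only [h1, h2]
    constructor <;> ring
  | zero => simp
  | add f g _ _ hf hg =>
    simp only [map_add, hf.1, hg.1, hf.2, hg.2, neg_add, and_self]
  | smul r f _ hf =>
    simp only [map_smul, hf.1, hf.2, smul_neg, and_self]

/-- The linear extension of `flexMon`. -/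
def toFlex (k : Type*) [Field k] : FreeOp k →ₗ[k] FreeNonUnitalNonAssocAlgebra k ℕ :=
  Finsupp.linearCombination k fun t => flexMon t 0

theorem toFlex_mon (t : Tree) : toFlex k (mon k t) = flexMon t 0 := by
  simp [toFlex, mon]

theorem augmentation_asMon (t : Tree) (i : ℕ) :
    FreeAlgebra.lift k (fun _ : ℕ => (1 : k)) (asMon t i) = 1 := by
  induction t generalizing i with
  | leaf => simp [asMon]
  | node o l r hl hr => simp [asMon, hl, hr]

/-- Sending every associative variable to `1` maps each `asMon` to `1`, which collapses the tensor
product onto its flexible factor. -/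
theorem toFlex_mem_flexRel {f : FreeOp k} (hf : toAsFlex k f = 0) : toFlex k f ∈ flexRel k := by
  have key : (TensorProduct.lid k _).toLinearMap ∘ₗ
      (FreeAlgebra.lift k (fun _ : ℕ => (1 : k))).toLinearMap.rTensor _ ∘ₗ toAsFlex k =
      (flexRel k).mkQ ∘ₗ toFlex k := by
    refine linearMap_ext_mon fun t => ?_
    simp [toAsFlex, toFlex, mon, augmentation_asMon]
  have := LinearMap.congr_fun key f
  simp only [LinearMap.comp_apply, hf, map_zero] at this
  exact (Submodule.Quotient.mk_eq_zero _).1 this.symm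

theorem Tree.arity_eq_one {t : Tree} (h : t.arity = 1) : t = leaf := by
  cases t with
  | leaf => rfl
  | node o l r =>
    have := l.arity_pos
    have := r.arity_pos
    simp only [Tree.arity] at h
    omega

theorem Tree.arity_eq_two {t : Tree} (h : t.arity = 2) : ∃ o, t = node o leaf leaf := by
  cases t with
  | leaf => simp [Tree.arity] at h
  | node o l r =>
    have := l.arity_pos
    have := r.arity_pos
    simp only [Tree.arity] at h
    exact ⟨o, by rw [Tree.arity_eq_one (t := l) (by omega), Tree.arity_eq_one (t := r) (by omega)]⟩

theorem Tree.arity_eq_three {t : Tree} (h : t.arity = 3) :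
    ∃ o o', t = node o leaf (node o' leaf leaf) ∨ t = node o (node o' leaf leaf) leaf := by
  cases t with
  | leaf => simp [Tree.arity] at h
  | node o l r =>
    have := l.arity_pos
    have := r.arity_pos
    simp only [Tree.arity] at h
    rcases (show l.arity = 1 ∧ r.arity = 2 ∨ l.arity = 2 ∧ r.arity = 1 by omega) with h | h
    · obtain ⟨o', rfl⟩ := Tree.arity_eq_two h.2
      exact ⟨o, o', Or.inl (by rw [Tree.arity_eq_one h.1])⟩
    · obtain ⟨o', rfl⟩ := Tree.arity_eq_two h.1
      exact ⟨o, o', Or.inr (by rw [Tree.arity_eq_one h.2])⟩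

theorem eq_of_mem_component_three {f : FreeOp k} (hf : f ∈ component k 3) :
    f = f (node .x leaf (node .x leaf leaf)) • mon k (node .x leaf (node .x leaf leaf))
      + f (node .x leaf (node .y leaf leaf)) • mon k (node .x leaf (node .y leaf leaf))
      + f (node .y leaf (node .x leaf leaf)) • mon k (node .y leaf (node .x leaf leaf))
      + f (node .y leaf (node .y leaf leaf)) • mon k (node .y leaf (node .y leaf leaf))
      + f (node .x (node .x leaf leaf) leaf) • mon k (node .x (node .x leaf leaf) leaf)
      + f (node .x (node .y leaf leaf) leaf) • mon k (node .x (node .y leaf leaf) leaf)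
      + f (node .y (node .x leaf leaf) leaf) • mon k (node .y (node .x leaf leaf) leaf)
      + f (node .y (node .y leaf leaf) leaf) • mon k (node .y (node .y leaf leaf) leaf) := by
  ext t
  by_cases ht : t.arity = 3
  · obtain ⟨o, o', rfl | rfl⟩ := Tree.arity_eq_three ht <;> cases o <;> cases o' <;>
      simp [mon]
  · have h0 : f t = 0 := by
      by_contra h
      exact ht (mem_component.1 hf t (Finsupp.mem_support_iff.2 h))
    have hne (s : Tree) (hs : s.arity = 3) : mon k s t = 0 :=
      Finsupp.single_eq_of_ne (by rintro rfl; exact ht hs)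
    simp only [Finsupp.add_apply, Finsupp.smul_apply, h0]
    rw [hne _ rfl, hne _ rfl, hne _ rfl, hne _ rfl, hne _ rfl, hne _ rfl, hne _ rfl, hne _ rfl]
    simp only [smul_zero, add_zero]

/-- In a tree of arity three the middle leaf always lies in the inner product, so `(02)1` and
`(20)1` never occur. The flexible symmetries tie the four mixed trees to these, forcing their
coefficients to vanish, and tie the four trees with equal labels to one another. -/
theorem eq_smul_rule₁ {f : FreeOp k} (hf : f ∈ component k 3) (h0 : toAsFlex k f = 0) :
    f = f lead₁ • rule₁ k := by
  have hrel := magmaCoeff_flexRel (toFlex_mem_flexRel h0)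
  rw [eq_of_mem_component_three hf] at hrel
  simp only [map_add, map_smul, toFlex_mon, flexMon, Tree.arity, zero_add, Nat.reduceAdd,
    of_mul_of_mul_of, of_mul_of_mul_of', magmaCoeff_single, freeMagma_mul_inj, freeMagma_of_inj,
    freeMagma_of_ne_mul, freeMagma_mul_ne_of, smul_eq_mul] at hrel
  have r1 := hrel 0 1 2
  have r2 := hrel 2 1 0
  have r3 := hrel 0 2 1
  have r4 := hrel 2 0 1
  simp at r1 r2 r3 r4
  refine (eq_of_mem_component_three hf).trans ?_
  rw [r1.2, r1.1, r2.2, r3.2, ← r3.1, ← r4.1, r4.2]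
  simp only [rule₁, lead₁, zero_smul, add_zero, neg_smul, smul_sub, smul_add]
  abel

theorem toFlex_rule₁ : toFlex k (rule₁ k) = flexLaw (FreeNonUnitalNonAssocAlgebra.of k 0)
    (FreeNonUnitalNonAssocAlgebra.of k 1) (FreeNonUnitalNonAssocAlgebra.of k 2) := by
  simp only [rule₁, lead₁, map_sub, map_add, toFlex_mon, flexMon, flexLaw, Tree.arity, zero_add,
    Nat.reduceAdd]
  abel

theorem toAsFlex_rule₁ : toAsFlex k (rule₁ k) = 0 := by
  have hmon (t : Tree) (ht : asMon t 0 =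
      FreeAlgebra.ι k 0 * FreeAlgebra.ι k 1 * FreeAlgebra.ι k 2) : toAsFlex k (mon k t) =
      TensorProduct.mk k _ _ (FreeAlgebra.ι k 0 * FreeAlgebra.ι k 1 * FreeAlgebra.ι k 2)
        ((flexRel k).mkQ (toFlex k (mon k t))) := by
    simp [toAsFlex, toFlex, mon, ht]
  have hmem : toFlex k (rule₁ k) ∈ flexRel k := by
    rw [toFlex_rule₁]
    exact Submodule.subset_span ⟨1, rfl⟩
  have h : toAsFlex k (rule₁ k) =
      TensorProduct.mk k _ _ (FreeAlgebra.ι k 0 * FreeAlgebra.ι k 1 * FreeAlgebra.ι k 2)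
        ((flexRel k).mkQ (toFlex k (rule₁ k))) := by
    simp only [rule₁, lead₁, map_sub, map_add]
    rw [hmon, hmon, hmon, hmon] <;> simp [asMon, Tree.arity, mul_assoc]
  rw [h, Submodule.mkQ_apply, (Submodule.Quotient.mk_eq_zero _).2 hmem, map_zero]

theorem operadIdeal_rule₁ : operadIdeal {rule₁ k} = nonComFlexIdeal k := by
  refine operadIdeal_eq_of ?_ ?_
  · rintro n _ rfl hn
    exact .of ⟨rule₁_mem_component, toAsFlex_rule₁⟩ hn
  · rintro n f ⟨hf, h0⟩ hn
    -- Zero lies in every component, so only a nonzero `f` determines `n = 3`.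
    by_cases hz : f = 0
    · rw [hz]; exact .zero n
    · obtain ⟨t, ht⟩ := Finsupp.support_nonempty_iff.2 hz
      obtain rfl : n = 3 := by rw [← mem_component.1 hn t ht, mem_component.1 hf t ht]
      rw [eq_smul_rule₁ hf h0]
      exact .smul _ (.of rfl rule₁_mem_component)

end NonComFlex

end

/-- The first rule alone (the defining identity) generates the ideal of relations of
`non-com-Flex`; there are admissible orders for which the left-hand sides of the two rules are
their leading monomials; and for every such order the two rules form a Gröbner basis. -/
theorem mainTheorem9 (k : Type*) [Field k] :
    NonComFlex.operadIdeal {NonComFlex.rule₁ k} = NonComFlex.nonComFlexIdeal k ∧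
    (∃ lt : NonComFlex.Tree → NonComFlex.Tree → Prop, NonComFlex.IsMonomialOrder lt ∧
      NonComFlex.IsLeading lt (NonComFlex.rule₁ k) NonComFlex.lead₁ ∧
      NonComFlex.IsLeading lt (NonComFlex.rule₂ k) NonComFlex.lead₂) ∧
    ∀ lt : NonComFlex.Tree → NonComFlex.Tree → Prop, NonComFlex.IsMonomialOrder lt →
      NonComFlex.IsLeading lt (NonComFlex.rule₁ k) NonComFlex.lead₁ →
      NonComFlex.IsLeading lt (NonComFlex.rule₂ k) NonComFlex.lead₂ →
      NonComFlex.IsGroebnerBasis lt {NonComFlex.rule₁ k, NonComFlex.rule₂ k}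
        (NonComFlex.nonComFlexIdeal k) := by
  refine ⟨NonComFlex.operadIdeal_rule₁, ⟨_, NonComFlex.isMonomialOrder_pathLt,
    NonComFlex.isLeading_rule₁, NonComFlex.isLeading_rule₂⟩, fun lt hlt h₁ h₂ => ?_⟩
  rw [← NonComFlex.operadIdeal_rule₁]
  exact hlt.isGroebnerBasis h₁ h₂
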